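/- Let $A,E\in\mathbb C^{n\times n}$ and $\epsilon>0$. For $z$ in the resolvent set $\rho(A)=\mathbb C\setminus\mathrm{eig}(A)$ let $r_\sigma(E(A-zI)^{-1})$ be the spectral radius of $E(A-zI)^{-1}$, and put $$D_\phi:=\rho(A)\cup\{\lambda\in\mathrm{eig}(A):\ \limsup_{z\to\lambda,\ z\in\rho(A)} r_\sigma(E(A-zI)^{-1})<\infty\}.$$ Let $\phi$ be the unique subharmonic extension of $z\mapsto r_\sigma(E(A-zI)^{-1})$ to $D_\phi$, with $\phi(z):=\infty$ for $z\notin D_\phi$, and let $$\sigma_\epsilon(A,E):=\{z\in\mathbb C:\ \phi(z)\ge\epsilon^{-1}\}.$$ For a matrix $M$ and a set $S\subseteq\mathrm{eig}(M)$, the spectral projection of $M$ associated with $S$ is the projection $P$ onto the sum of the generalized eigenspaces of $M$ for the eigenvalues in $S$ along the sum of those for the eigenvalues in $\mathrm{eig}(M)\setminus S$; equivalently, $P^2=P$, $PM=MP$, $\mathrm{eig}(M|_{R(P)})=S$ and $\mathrm{eig}(M|_{N(P)})=\mathrm{eig}(M)\setminus S$, where $R(P)$ and $N(P)$ are the range and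 the kernel of $P$. Suppose that $\sigma_\epsilon(A,E)$ has $m\ge 0$ connected components $\Delta_1,\dots,\Delta_m$. Let $\sigma_0:=\mathrm{eig}(A)\setminus\sigma_\epsilon(A,E)$ and, for $t\in\mathbb C$, let $\sigma_0(t):=\mathrm{eig}(A+tE)\setminus\sigma_\epsilon(A,E)$ and $\sigma_j(t):=\mathrm{eig}(A+tE)\cap\Delta_j$ for $j=1,\dots,m$. Let $P_j(t)$ be the spectral projection of $A+tE$ associated with $\sigma_j(t)$, $j=0,\dots,m$. Then: 1. $\sigma_0(t)=\sigma_0$, and $\sigma_j(t)\neq\emptyset$ for $j=1,\dots,m$, for all $|t|\le\epsilon$. 2. For $j=0,\dots,m$ the function $t\mapsto P_j(t)$ is analytic for $|t|\le\epsilon$, that is, on the closed disc it agrees with a function analytic in a neighbourhood of that disc. 3. $\mathrm{eig}((A+tE)|_{R(P_0(t))})=\sigma_0$ and $\mathrm{eig}((A+tE)|_{R(P_j(t))})=\sigma_j(t)\subseteq\Delta_j$ for all $|t|\le\epsilon$ and $j=1,\dots,m$. 4. $P_0(t)+P_1(t)+\cdots+P_m(t)=I$ for all $|t|\le\epsilon$.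 5. For $j=1,\dots,m$ and all $|t|\le\epsilon$, the set $\Delta_j$ contains the same number of eigenvalues of $A+tE$ as of $A$, counted with algebraic multiplicity. -/

import Mathlib

open Filter Topology MeasureTheory Metric Set
open scoped ENNReal NNReal

namespace DirectionalPseudospectrum

/-! ### Subharmonic functions with values in `[0, ∞]` -/

/-- The mean value `(1 / 2π) ∫₀^{2π} u (c + r e^{iθ}) dθ` of a `[0, ∞]`-valued function. -/
noncomputable def circleMean (u : ℂ → ℝ≥0∞) (c : ℂ) (r : ℝ) : ℝ≥0∞ :=
  (ENNReal.ofReal (2 * Real.pi))⁻¹ * ∫⁻ θ in Ioc (0 : ℝ) (2 * Real.pi), u (circleMap c r θ)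

/-- A (nonnegative) function `u` is subharmonic on the open set `D`: it is finite and upper
semicontinuous on `D` and satisfies the local submean inequality. The last field also forces `D`
to be open. -/
structure IsSubharmonicOn (u : ℂ → ℝ≥0∞) (D : Set ℂ) : Prop where
  lt_top : ∀ z ∈ D, u z < ⊤
  usc : UpperSemicontinuousOn u D
  submean : ∀ z ∈ D, ∃ δ > 0, closedBall z δ ⊆ D ∧ ∀ r, 0 < r → r ≤ δ → u z ≤ circleMean u z r

/-! ### The function `φ` and the directional pseudospectrum -/

/-- `r_σ(E (A - z I)⁻¹)`, to be used for `z` in the resolvent set of `A`. -/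
noncomputable def resolventRadius {n : ℕ} (A E : Matrix (Fin n) (Fin n) ℂ) (z : ℂ) : ℝ≥0∞ :=
  spectralRadius ℂ (E * (A - z • (1 : Matrix (Fin n) (Fin n) ℂ))⁻¹)

/-- The domain `D_φ`: the resolvent set of `A` together with those eigenvalues of `A` at which
`limsup r_σ(E (A - z I)⁻¹)`, over `z` in the resolvent set, is finite. -/
def extDomain {n : ℕ} (A E : Matrix (Fin n) (Fin n) ℂ) : Set ℂ :=
  (spectrum ℂ A)ᶜ ∪
    {z ∈ spectrum ℂ A | limsup (resolventRadius A E) (𝓝[(spectrum ℂ A)ᶜ] z) < ⊤}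

/-- `u` is a subharmonic extension of `z ↦ r_σ(E (A - z I)⁻¹)` from the resolvent set of `A` to
`D_φ`, with the convention that `u = ∞` off `D_φ`. -/
structure IsSubharmonicExtension {n : ℕ} (A E : Matrix (Fin n) (Fin n) ℂ) (u : ℂ → ℝ≥0∞) :
    Prop where
  eq_on_resolventSet : ∀ z ∉ spectrum ℂ A, u z = resolventRadius A E z
  subharmonic : IsSubharmonicOn u (extDomain A E)
  eq_top : ∀ z ∉ extDomain A E, u z = ⊤

open Classical in
/-- The function `φ`. By `subharmonicExt_isSubharmonicExtension` and
`IsSubharmonicExtension.eq_subharmonicExt` below it is the unique subharmonic extension of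
`r_σ(E (A - z I)⁻¹)` to `D_φ`, extended by `∞` off `D_φ`. -/
noncomputable def subharmonicExt {n : ℕ} (A E : Matrix (Fin n) (Fin n) ℂ) (z : ℂ) : ℝ≥0∞ :=
  if z ∈ spectrum ℂ A then limsup (resolventRadius A E) (𝓝[(spectrum ℂ A)ᶜ] z)
  else resolventRadius A E z

/-- The directional pseudospectrum `σ_ε(A, E) = {z | φ(z) ≥ ε⁻¹}`. -/
def dirPseudospectrum {n : ℕ} (A E : Matrix (Fin n) (Fin n) ℂ) (ε : ℝ) : Set ℂ :=
  {z | ENNReal.ofReal ε⁻¹ ≤ subharmonicExt A E z}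

/-! ### Spectral projections -/

/-- The sum of the generalized eigenspaces of `M` for the points of `S`. -/
noncomputable def spectralSubspace {n : ℕ} (M : Matrix (Fin n) (Fin n) ℂ) (S : Set ℂ) :
    Submodule ℂ (Fin n → ℂ) :=
  ⨆ μ ∈ S, Module.End.maxGenEigenspace (Matrix.toLin' M) μ

theorem isCompl_spectralSubspace {n : ℕ} (M : Matrix (Fin n) (Fin n) ℂ) (S : Set ℂ) :
    IsCompl (spectralSubspace M S) (spectralSubspace M Sᶜ) := by
  constructor
  · exact (Module.End.independent_maxGenEigenspace (Matrix.toLin' M)).disjoint_biSup_biSup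
      disjoint_compl_right
  · rw [codisjoint_iff, spectralSubspace, spectralSubspace, ← iSup_union, union_compl_self,
      iSup_univ]
    exact Module.End.iSup_maxGenEigenspace_eq_top _

/-- The spectral projection of `M` for `S`: the projection onto the sum of the generalized
eigenspaces for the eigenvalues in `S`, along the sum of those for the eigenvalues not in `S`. -/
noncomputable def spectralProjection {n : ℕ} (M : Matrix (Fin n) (Fin n) ℂ) (S : Set ℂ) :
    Matrix (Fin n) (Fin n) ℂ :=
  LinearMap.toMatrix'
    ((spectralSubspace M S).projection (spectralSubspace M Sᶜ) (isCompl_spectralSubspace M S))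

/-- The eigenvalues of the restriction of `M` to an invariant subspace `Y`. -/
def eigOn {n : ℕ} (M : Matrix (Fin n) (Fin n) ℂ) (Y : Submodule ℂ (Fin n → ℂ)) : Set ℂ :=
  {z | ∃ v ∈ Y, v ≠ 0 ∧ M.mulVec v = z • v}

/-- `P` is a projection that commutes with `M`, the restriction of `M` to the range of `P` has
spectrum `S`, and the restriction to the kernel of `P` has spectrum `eig(M) \ S`. -/
structure IsSpectralProjection {n : ℕ} (M : Matrix (Fin n) (Fin n) ℂ) (S : Set ℂ)
    (P : Matrix (Fin n) (Fin n) ℂ) : Prop where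
  idem : P * P = P
  comm : P * M = M * P
  eig_range : eigOn M (LinearMap.range (Matrix.toLin' P)) = S
  eig_ker : eigOn M (LinearMap.ker (Matrix.toLin' P)) = spectrum ℂ M \ S

/-- A matrix function is analytic for `|t| ≤ ε`: on the closed disc it agrees with a function that
is (entrywise) analytic in a neighbourhood of each point of the closed disc. -/
def AnalyticOnClosedDisc {n : ℕ} (P : ℂ → Matrix (Fin n) (Fin n) ℂ) (ε : ℝ) : Prop :=
  ∃ Q : ℂ → Matrix (Fin n) (Fin n) ℂ,
    (∀ i k, AnalyticOnNhd ℂ (fun t => Q t i k) (closedBall 0 ε)) ∧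
    ∀ t ∈ closedBall (0 : ℂ) ε, P t = Q t

open Classical in
/-- The number of eigenvalues of `M` in `S`, counted with algebraic multiplicity. -/
noncomputable def eigCount {n : ℕ} (M : Matrix (Fin n) (Fin n) ℂ) (S : Set ℂ) : ℕ :=
  (M.charpoly.roots.filter (· ∈ S)).card

/-! ### `φ` is the unique subharmonic extension -/

theorem rpow_norm_le_circleAverage {h : ℂ → ℂ} {c : ℂ} {R p : ℝ} (hR : 0 < R) (hp : 0 < p)
    (hh : AnalyticOnNhd ℂ h (closedBall c R)) :
    ‖h c‖ ^ p ≤ Real.circleAverage (fun z => ‖h z‖ ^ p) c R := by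
  have habs : |R| = R := abs_of_pos hR
  by_cases h0 : h c = 0
  · rw [h0, norm_zero, Real.zero_rpow hp.ne']
    exact Real.circleAverage_nonneg_of_nonneg fun _ _ => by positivity
  have ha : 0 < ‖h c‖ := norm_pos_iff.2 h0
  set a := ‖h c‖ with had
  have hJ := AnalyticOnNhd.circleAverage_log_norm hR.ne' (by rwa [habs]) h0
  have hcont : ContinuousOn (fun z => ‖h z‖ ^ p) (sphere c |R|) := by
    rw [habs]
    exact ((hh.continuousOn.mono sphere_subset_closedBall).norm).rpow_const
      (fun _ _ => Or.inr hp.le)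
  have hI1 : CircleIntegrable (fun z => Real.log ‖h z‖) c R :=
    ((hh.mono sphere_subset_closedBall).meromorphicOn.circleIntegrable_log_norm_of_nonneg hR.le)
  set f2 : ℂ → ℝ := fun z => if h z = 0 then a ^ p * (1 + p * (Real.log ‖h z‖ - Real.log a))
    else ‖h z‖ ^ p with hf2
  have hev : (fun z => ‖h z‖ ^ p) =ᶠ[codiscreteWithin (sphere c |R|)] f2 := by
    have := AnalyticOnNhd.preimage_zero_mem_codiscreteWithin hh h0
      (mem_closedBall_self hR.le) ((convex_closedBall c R).isConnected ⟨c, mem_closedBall_self hR.le⟩)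
    have := codiscreteWithin_mono (U₁ := sphere c |R|) (by rw [habs]; exact sphere_subset_closedBall) this
    filter_upwards [this] with z hz
    have : h z ≠ 0 := by simpa using hz
    simp [hf2, this]
  rw [Real.circleAverage_congr_codiscreteWithin hev hR.ne']
  have hI2 : CircleIntegrable f2 c R := hcont.circleIntegrable'.congr_codiscreteWithin hev
  have hI3 : CircleIntegrable (fun z => a ^ p * (1 + p * (Real.log ‖h z‖ - Real.log a))) c R := by
    have h1 : CircleIntegrable (fun z => p * (Real.log ‖h z‖ - Real.log a)) c R :=
      (hI1.sub (circleIntegrable_const (Real.log a) c R)).const_mul p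
    exact ((circleIntegrable_const (1:ℝ) c R).add h1).const_mul _
  have hmono := Real.circleAverage_mono hI3 hI2 (by
    intro z _
    by_cases hz : h z = 0
    · simp [hf2, hz]
    · simp only [hf2, hz, if_false]
      have hz' : 0 < ‖h z‖ := norm_pos_iff.2 hz
      have h1 : ‖h z‖ ^ p = a ^ p * Real.exp (p * (Real.log ‖h z‖ - Real.log a)) := by
        rw [Real.rpow_def_of_pos hz', Real.rpow_def_of_pos ha, ← Real.exp_add]; ring_nf
      rw [h1]
      have := Real.add_one_le_exp (p * (Real.log ‖h z‖ - Real.log a))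
      gcongr
      linarith)
  refine le_trans ?_ hmono
  have e1 : Real.circleAverage (fun z => a ^ p * (1 + p * (Real.log ‖h z‖ - Real.log a))) c R
      = a ^ p * (1 + p * (Real.circleAverage (fun z => Real.log ‖h z‖) c R - Real.log a)) := by
    have hs : CircleIntegrable (fun z => Real.log ‖h z‖ - Real.log a) c R :=
      hI1.sub (circleIntegrable_const (Real.log a) c R)
    have e2 := Real.circleAverage_fun_sub hI1 (circleIntegrable_const (Real.log a) c R)
    have e3 := Real.circleAverage_fun_smul (a := p) (f := fun z => Real.log ‖h z‖ - Real.log a) (c := c) (R := R)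
    have hs' : CircleIntegrable (fun z => p * (Real.log ‖h z‖ - Real.log a)) c R := hs.const_mul p
    have e4 := Real.circleAverage_fun_add (circleIntegrable_const (1:ℝ) c R) hs'
    have e5 := Real.circleAverage_fun_smul (a := a ^ p) (f := fun z => 1 + p * (Real.log ‖h z‖ - Real.log a)) (c := c) (R := R)
    simp only [smul_eq_mul, Real.circleAverage_const] at e2 e3 e4 e5
    rw [e5, e4, e3, e2]
  rw [e1, hJ]
  have hS : 0 ≤ ∑ᶠ u, ((MeromorphicOn.divisor h (closedBall c |R|)) u : ℝ) * Real.log (R * ‖c - u‖⁻¹) := by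
    refine finsum_nonneg fun u => ?_
    by_cases hu : u ∈ closedBall c |R|
    · have hd : (0 : ℤ) ≤ MeromorphicOn.divisor h (closedBall c |R|) u :=
        (MeromorphicOn.AnalyticOnNhd.divisor_nonneg (by rwa [habs])) u
      refine mul_nonneg (by exact_mod_cast hd) ?_
      rcases eq_or_ne u c with rfl | huc
      · simp
      · apply Real.log_nonneg
        have : 0 < ‖c - u‖ := norm_pos_iff.2 (sub_ne_zero.2 huc.symm)
        rw [← div_eq_mul_inv, one_le_div this]
        rw [habs, mem_closedBall, dist_comm, dist_eq_norm] at hu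
        exact hu
    · rw [Function.locallyFinsuppWithin.apply_eq_zero_of_notMem _ hu]; simp
  have : 0 < a ^ p := Real.rpow_pos_of_pos ha p
  nlinarith [mul_nonneg hp.le hS, mul_nonneg this.le (mul_nonneg hp.le hS)]

theorem ofReal_rpow_norm_le_circleMean {V : Type*} [NormedAddCommGroup V] [NormedSpace ℂ V]
    {H : ℂ → V} {c : ℂ} {R p : ℝ} (hR : 0 < R) (hp : 0 < p)
    (hH : AnalyticOnNhd ℂ H (closedBall c R)) :
    ENNReal.ofReal (‖H c‖ ^ p) ≤ circleMean (fun z => ENNReal.ofReal (‖H z‖ ^ p)) c R := by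
  have habs : |R| = R := abs_of_pos hR
  have hcont : ContinuousOn (fun z => ‖H z‖ ^ p) (sphere c |R|) := by
    rw [habs]
    exact ((hH.continuousOn.mono sphere_subset_closedBall).norm).rpow_const
      (fun _ _ => Or.inr hp.le)
  have hI : CircleIntegrable (fun z => ‖H z‖ ^ p) c R := hcont.circleIntegrable'
  have hreal : ‖H c‖ ^ p ≤ Real.circleAverage (fun z => ‖H z‖ ^ p) c R := by
    by_cases h0 : ‖H c‖ = 0
    · rw [h0, Real.zero_rpow hp.ne']
      exact Real.circleAverage_nonneg_of_nonneg fun _ _ => by positivity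
    obtain ⟨g, hg, hgc⟩ := exists_dual_vector ℂ (H c) h0
    have han : AnalyticOnNhd ℂ (fun z => g (H z)) (closedBall c R) := fun z hz =>
      (g.analyticAt _).comp (hH z hz)
    have h1 := rpow_norm_le_circleAverage hR hp han
    have h2 : ‖g (H c)‖ = ‖H c‖ := by rw [hgc]; simp
    rw [h2] at h1
    refine h1.trans (Real.circleAverage_mono ?_ hI ?_)
    · refine ContinuousOn.circleIntegrable' ?_
      rw [habs]
      exact ((han.continuousOn.mono sphere_subset_closedBall).norm).rpow_const
        (fun _ _ => Or.inr hp.le)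
    · intro z _
      have : ‖g (H z)‖ ≤ ‖H z‖ := by simpa [hg] using g.le_opNorm (H z)
      gcongr
  refine (ENNReal.ofReal_le_ofReal hreal).trans (le_of_eq ?_)
  rw [circleMean, Real.circleAverage_def, intervalIntegral.integral_of_le Real.two_pi_pos.le,
    smul_eq_mul, ENNReal.ofReal_mul (by positivity), ENNReal.ofReal_inv_of_pos Real.two_pi_pos,
    ofReal_integral_eq_lintegral_ofReal]
  · exact (intervalIntegrable_iff_integrableOn_Ioc_of_le Real.two_pi_pos.le).1 hI
  · exact Eventually.of_forall fun _ => by dsimp; positivity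

theorem spectralRadius_le_circleMean {𝒜 : Type*} [NormedRing 𝒜] [NormedAlgebra ℂ 𝒜]
    [CompleteSpace 𝒜] {F : ℂ → 𝒜} {c : ℂ} {R : ℝ} (hR : 0 < R)
    (hF : AnalyticOnNhd ℂ F (closedBall c R)) :
    spectralRadius ℂ (F c) ≤ circleMean (fun z => spectralRadius ℂ (F z)) c R := by
  have hlim := fun z => spectrum.pow_norm_pow_one_div_tendsto_nhds_spectralRadius (F z)
  have hlim' := fun z => (tendsto_add_atTop_iff_nat 1).2 (hlim z)
  refine le_of_tendsto_of_tendsto' (hlim' c) (g := fun n : ℕ =>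
    circleMean (fun z => ENNReal.ofReal (‖F z ^ (n + 1)‖ ^ (1 / ((n + 1 : ℕ) : ℝ)))) c R) ?_ ?_
  · unfold circleMean
    refine ENNReal.Tendsto.const_mul ?_ (Or.inr (by simp [Real.pi_pos]))
    have hmem : ∀ θ, circleMap c R θ ∈ closedBall c R := fun θ =>
      circleMap_mem_closedBall c hR.le θ
    have hFc : Continuous fun θ => F (circleMap c R θ) :=
      hF.continuousOn.comp_continuous (continuous_circleMap c R) hmem
    obtain ⟨M, hM⟩ := ((isCompact_closedBall c R).image_of_continuousOn hF.continuousOn).isBounded.exists_norm_le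
    refine tendsto_lintegral_of_dominated_convergence (fun _ => ENNReal.ofReal M) ?_ ?_ ?_ ?_
    · intro n
      exact (ENNReal.continuous_ofReal.comp ((hFc.pow _).norm.rpow_const
        (fun _ => Or.inr (by positivity)))).measurable
    · intro n
      refine Eventually.of_forall fun θ => ENNReal.ofReal_le_ofReal ?_
      have h1 : ‖F (circleMap c R θ) ^ (n + 1)‖ ≤ ‖F (circleMap c R θ)‖ ^ (n + 1) :=
        norm_pow_le' _ (Nat.succ_pos n)
      calc ‖F (circleMap c R θ) ^ (n + 1)‖ ^ (1 / ((n + 1 : ℕ) : ℝ))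
          ≤ (‖F (circleMap c R θ)‖ ^ (n + 1)) ^ (1 / ((n + 1 : ℕ) : ℝ)) := by gcongr
        _ = ‖F (circleMap c R θ)‖ := by
            rw [one_div, Real.pow_rpow_inv_natCast (norm_nonneg _) (Nat.succ_ne_zero n)]
        _ ≤ M := hM _ ⟨_, hmem θ, rfl⟩
    · simp [ENNReal.mul_eq_top]
    · exact Eventually.of_forall fun θ => hlim' _
  · intro n
    exact ofReal_rpow_norm_le_circleMean hR (by positivity) (hF.pow (n + 1))

theorem upperSemicontinuousAt_spectralRadius {𝒜 : Type*} [NormedRing 𝒜] [NormedAlgebra ℂ 𝒜]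
    [CompleteSpace 𝒜] [NormOneClass 𝒜] (a : 𝒜) :
    UpperSemicontinuousAt (fun x : 𝒜 => spectralRadius ℂ x) a := by
  intro M hM
  have h1 := (tendsto_add_atTop_iff_nat 1).2
    (spectrum.pow_nnnorm_pow_one_div_tendsto_nhds_spectralRadius a)
  obtain ⟨n, hn⟩ := (h1.eventually_lt_const hM).exists
  have hcont : Continuous fun x : 𝒜 => (‖x ^ (n + 1)‖₊ : ℝ≥0∞) ^ (1 / ((n + 1 : ℕ) : ℝ)) :=
    ENNReal.continuous_rpow_const.comp (ENNReal.continuous_coe.comp (continuous_pow (n+1)).nnnorm)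
  filter_upwards [hcont.continuousAt.eventually_lt_const hn] with x hx
  refine lt_of_le_of_lt (spectrum.spectralRadius_le_pow_nnnorm_pow_one_div ℂ x n) ?_
  simpa using hx

theorem circleMean_le_of_forall_le {u : ℂ → ℝ≥0∞} {c : ℂ} {r : ℝ} {M : ℝ≥0∞}
    (h : ∀ θ, u (circleMap c r θ) ≤ M) : circleMean u c r ≤ M := by
  have h1 : ∫⁻ θ in Ioc (0 : ℝ) (2 * Real.pi), u (circleMap c r θ)
      ≤ ENNReal.ofReal (2 * Real.pi) * M := by
    refine (lintegral_mono fun θ => h θ).trans (le_of_eq ?_)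
    simp [mul_comm]
  have hpos : ENNReal.ofReal (2 * Real.pi) ≠ 0 := by simp [Real.pi_pos]
  calc circleMean u c r
      ≤ (ENNReal.ofReal (2 * Real.pi))⁻¹ * (ENNReal.ofReal (2 * Real.pi) * M) := by
        unfold circleMean; gcongr
    _ = M := by rw [← mul_assoc, ENNReal.inv_mul_cancel hpos ENNReal.ofReal_ne_top, one_mul]

theorem limsup_eq_of_submean {u : ℂ → ℝ≥0∞} {c : ℂ} (husc : UpperSemicontinuousAt u c)
    {δ : ℝ} (hδ : 0 < δ) (hmean : ∀ r, 0 < r → r ≤ δ → u c ≤ circleMean u c r) :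
    limsup u (𝓝[≠] c) = u c := by
  apply le_antisymm
  · refine le_of_forall_gt fun M hM => ?_
    obtain ⟨M', h1, h2⟩ := exists_between hM
    refine lt_of_le_of_lt (limsup_le_of_le (h := ?_)) h2
    filter_upwards [(husc M' h1).filter_mono nhdsWithin_le_nhds] with z hz using hz.le
  · refine le_of_forall_gt fun M hM => ?_
    obtain ⟨M', h1, h2⟩ := exists_between hM
    have hev := eventually_lt_of_limsup_lt h1
    rw [eventually_nhdsWithin_iff, Metric.eventually_nhds_iff] at hev
    obtain ⟨η, hη, hev⟩ := hev
    have hr : 0 < min δ (η / 2) := by positivity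
    refine lt_of_le_of_lt ((hmean _ hr (min_le_left _ _)).trans
      (circleMean_le_of_forall_le fun θ => (hev ?_ ?_).le)) h2
    · rw [dist_eq_norm, circleMap_sub_center, norm_circleMap_zero, abs_of_pos hr]
      exact lt_of_le_of_lt (min_le_right _ _) (by linarith)
    · exact circleMap_ne_center hr.ne'

theorem spectralRadius_eq_of_charpoly_eq {n : ℕ} {M N : Matrix (Fin n) (Fin n) ℂ}
    (h : M.charpoly = N.charpoly) : spectralRadius ℂ M = spectralRadius ℂ N := by
  have : spectrum ℂ M = spectrum ℂ N := by
    ext z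
    rw [Matrix.mem_spectrum_iff_isRoot_charpoly, Matrix.mem_spectrum_iff_isRoot_charpoly, h]
  rw [spectralRadius, spectralRadius, this]

/-- The companion matrix of the monic polynomial of degree `n` with lower coefficients `a`. -/
def companionMatrix (n : ℕ) (a : ℕ → ℂ) : Matrix (Fin n) (Fin n) ℂ :=
  Matrix.of fun i j => if (j : ℕ) + 1 = n then -a i else if (i : ℕ) = j + 1 then 1 else 0

theorem companionMatrix_charpoly {n : ℕ} {p : Polynomial ℂ} (hp : p.Monic)
    (hn : p.natDegree = n) : (companionMatrix n p.coeff).charpoly = p := by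
  subst hn
  have h := charpoly_leftMulMatrix (AdjoinRoot.powerBasis (K := ℂ) hp.ne_zero)
  rw [AdjoinRoot.minpoly_powerBasis_gen_of_monic hp, PowerBasis.leftMulMatrix,
    PowerBasis.minpolyGen_eq, AdjoinRoot.minpoly_powerBasis_gen_of_monic hp] at h
  exact h

section MatrixNorm

attribute [local instance] Matrix.linftyOpNormedRing Matrix.linftyOpNormedAlgebra

variable {n : ℕ}

theorem analyticAt_matrix {F : ℂ → Matrix (Fin n) (Fin n) ℂ} {z : ℂ}
    (h : ∀ i j, AnalyticAt ℂ (fun w => F w i j) z) : AnalyticAt ℂ F z := by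
  have : F = fun w => ∑ i, ∑ j, F w i j • Matrix.single i j (1 : ℂ) := by
    funext w
    conv_lhs => rw [Matrix.matrix_eq_sum_single (F w)]
    simp [Matrix.smul_single]
  rw [this]
  exact Finset.analyticAt_fun_sum _ fun i _ => Finset.analyticAt_fun_sum _ fun j _ =>
    (h i j).smul analyticAt_const

theorem analyticAt_entry {F : ℂ → Matrix (Fin n) (Fin n) ℂ} {z : ℂ}
    (h : AnalyticAt ℂ F z) (i j : Fin n) : AnalyticAt ℂ (fun w => F w i j) z :=
  ((LinearMap.toContinuousLinearMap (Matrix.entryLinearMap ℂ ℂ i j)).analyticAt (F z)).comp h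

theorem analyticAt_resolvent (A E : Matrix (Fin n) (Fin n) ℂ) {z : ℂ} (hz : z ∉ spectrum ℂ A) :
    AnalyticAt ℂ (fun w => E * (A - w • (1 : Matrix (Fin n) (Fin n) ℂ))⁻¹) z := by
  have : CompleteSpace (Matrix (Fin n) (Fin n) ℂ) := FiniteDimensional.complete ℂ _
  have hu : IsUnit (A - z • (1 : Matrix (Fin n) (Fin n) ℂ)) := by
    rw [spectrum.notMem_iff, Algebra.algebraMap_eq_smul_one] at hz
    simpa using hz.neg
  have h1 : AnalyticAt ℂ (fun w : ℂ => A - w • (1 : Matrix (Fin n) (Fin n) ℂ)) z :=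
    analyticAt_const.sub (analyticAt_id.smul analyticAt_const)
  have h2 : AnalyticAt ℂ Ring.inverse (A - z • (1 : Matrix (Fin n) (Fin n) ℂ)) := by
    obtain ⟨x, hx⟩ := hu
    rw [← hx]; exact analyticAt_inverse x
  simp only [Matrix.nonsing_inv_eq_ringInverse]
  exact analyticAt_const.mul (h2.comp (f := fun w : ℂ => A - w • (1 : Matrix (Fin n) (Fin n) ℂ)) h1)

theorem analyticAt_charpoly_coeff {F : ℂ → Matrix (Fin n) (Fin n) ℂ} {z : ℂ}
    (h : AnalyticAt ℂ F z) (k : ℕ) : AnalyticAt ℂ (fun w => (F w).charpoly.coeff k) z := by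
  have h1 : ∀ w, (F w).charpoly.coeff k =
      MvPolynomial.aeval (fun ij : Fin n × Fin n => F w ij.1 ij.2)
        ((Matrix.charpoly.univ ℂ (Fin n)).coeff k) := by
    intro w
    have := Matrix.charpoly.univ_map_eval₂Hom (Fin n) (algebraMap ℂ ℂ)
      (fun ij : Fin n × Fin n => F w ij.1 ij.2)
    have h2 : (Matrix.of (Function.curry fun ij : Fin n × Fin n => F w ij.1 ij.2)) = F w := rfl
    rw [h2] at this
    rw [← this, Polynomial.coeff_map]
    rfl
  simp only [h1]
  exact AnalyticAt.aeval_mvPolynomial (𝕜 := ℂ) (B := ℂ)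
    (f := fun w (ij : Fin n × Fin n) => F w ij.1 ij.2)
    (fun ij => analyticAt_entry h ij.1 ij.2) ((Matrix.charpoly.univ ℂ (Fin n)).coeff k)

theorem upperSemicontinuousAt_spectralRadius_matrix {F : ℂ → Matrix (Fin n) (Fin n) ℂ} {z : ℂ}
    (h : ContinuousAt F z) : UpperSemicontinuousAt (fun w => spectralRadius ℂ (F w)) z := by
  rcases isEmpty_or_nonempty (Fin n) with hn | hn
  · intro M hM
    have : ∀ w, spectralRadius ℂ (F w) = 0 := fun w => spectrum.SpectralRadius.of_subsingleton _
    simp only [this] at hM ⊢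
    exact Eventually.of_forall fun _ => hM
  · have : CompleteSpace (Matrix (Fin n) (Fin n) ℂ) := FiniteDimensional.complete ℂ _
    have : NormOneClass (Matrix (Fin n) (Fin n) ℂ) := Matrix.linfty_opNormOneClass
    intro M hM
    exact h.eventually (upperSemicontinuousAt_spectralRadius (F z) M hM)

/-- Locally on its domain, the extension is the spectral radius of an analytic matrix function. -/
theorem exists_local_analytic (A E : Matrix (Fin n) (Fin n) ℂ) {c : ℂ} (hc : c ∈ extDomain A E) :
    ∃ F : ℂ → Matrix (Fin n) (Fin n) ℂ, ∃ δ > 0, AnalyticOnNhd ℂ F (closedBall c δ) ∧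
      closedBall c δ ⊆ extDomain A E ∧
      ∀ z ∈ closedBall c δ, subharmonicExt A E z = spectralRadius ℂ (F z) := by
  have : CompleteSpace (Matrix (Fin n) (Fin n) ℂ) := FiniteDimensional.complete ℂ _
  have hfin : (spectrum ℂ A).Finite := Matrix.finite_spectrum A
  by_cases hs : c ∈ spectrum ℂ A
  · obtain ⟨-, hlim⟩ : _ ∧ limsup (resolventRadius A E) (𝓝[(spectrum ℂ A)ᶜ] c) < ⊤ :=
      hc.resolve_left (fun h => h hs)
    have hS : (spectrum ℂ A \ {c})ᶜ ∈ 𝓝 c :=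
      (hfin.subset sdiff_subset).isClosed.isOpen_compl.mem_nhds (by simp)
    have hnhds : 𝓝[(spectrum ℂ A)ᶜ] c = 𝓝[≠] c := by
      refine nhdsWithin_eq_nhdsWithin' hS ?_
      ext z
      simp only [mem_inter_iff, mem_compl_iff, Set.mem_sdiff, mem_singleton_iff]
      by_cases hz : z = c <;> simp [hz, hs]
    rw [hnhds] at hlim
    obtain ⟨B, hB, hBtop⟩ := exists_between hlim
    have hev := eventually_lt_of_limsup_lt hB
    have hev2 : ∀ᶠ z in 𝓝[≠] c, z ∉ spectrum ℂ A := by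
      rw [← hnhds]; exact self_mem_nhdsWithin
    have hev3 := hev.and hev2
    rw [eventually_nhdsWithin_iff, Metric.eventually_nhds_iff] at hev3
    obtain ⟨η, hη, hball⟩ := hev3
    have hδ : 0 < η / 2 := by positivity
    set G : ℂ → Matrix (Fin n) (Fin n) ℂ :=
      fun w => E * (A - w • (1 : Matrix (Fin n) (Fin n) ℂ))⁻¹ with hG
    set a : ℕ → ℂ → ℂ := fun k => Function.update (fun w => (G w).charpoly.coeff k) c
      (limUnder (𝓝[≠] c) fun w => (G w).charpoly.coeff k) with ha
    have hadiff : ∀ k, DifferentiableOn ℂ (a k) (ball c η) := by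
      intro k
      refine Complex.differentiableOn_update_limUnder_of_bddAbove (ball_mem_nhds c hη) ?_ ?_
      · intro w hw
        exact (analyticAt_charpoly_coeff (analyticAt_resolvent A E
          (hball hw.1 hw.2).2) k).differentiableAt.differentiableWithinAt
      · refine ⟨max B.toReal 1 ^ n * n.choose (n / 2), ?_⟩
        rintro _ ⟨w, hw, rfl⟩
        have := Polynomial.coeff_bdd_of_roots_le (B := B.toReal) (d := n) (RingHom.id ℂ)
          (Matrix.charpoly_monic (G w)) (IsAlgClosed.splits _)
          (by rw [Matrix.charpoly_natDegree_eq_dim]; simp) (by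
            intro z hz
            rw [Polynomial.map_id, Polynomial.mem_roots (Matrix.charpoly_monic (G w)).ne_zero,
              ← Matrix.mem_spectrum_iff_isRoot_charpoly] at hz
            have h1 : (‖z‖₊ : ℝ≥0∞) ≤ spectralRadius ℂ (G w) :=
              le_iSup₂ (f := fun (k : ℂ) (_ : k ∈ spectrum ℂ (G w)) => (‖k‖₊ : ℝ≥0∞)) z hz
            have h2 := h1.trans (hball hw.1 hw.2).1.le
            have h3 := ENNReal.toReal_mono hBtop.ne h2
            simpa using h3) k
        simpa using this
    set F : ℂ → Matrix (Fin n) (Fin n) ℂ := fun w => companionMatrix n fun k => a k w with hF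
    have han : ∀ z ∈ ball c η, AnalyticAt ℂ F z := by
      intro z hz
      refine analyticAt_matrix fun i j => ?_
      simp only [hF, companionMatrix, Matrix.of_apply]
      split_ifs
      · exact ((hadiff i).analyticAt (isOpen_ball.mem_nhds hz)).neg
      · exact analyticAt_const
      · exact analyticAt_const
    refine ⟨F, η / 2, hδ, fun z hz => han z (closedBall_subset_ball (by linarith) hz), ?_, ?_⟩
    · intro z hz
      by_cases hzc : z = c
      · rw [hzc]; exact hc
      · exact Or.inl (hball (lt_of_le_of_lt hz (by linarith)) hzc).2
    · have hrad : ∀ z ∈ ball c η, z ≠ c → resolventRadius A E z =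
          spectralRadius ℂ (F z) := by
        intro z hz hzc
        refine spectralRadius_eq_of_charpoly_eq ?_
        have h1 : (fun k => a k z) = (G z).charpoly.coeff := by
          funext k; simp [ha, Function.update_of_ne hzc]
        change (G z).charpoly = (companionMatrix n fun k => a k z).charpoly
        rw [h1, companionMatrix_charpoly (Matrix.charpoly_monic _)
          (by rw [Matrix.charpoly_natDegree_eq_dim]; simp)]
      intro z hz
      by_cases hzc : z = c
      · subst hzc
        rw [subharmonicExt, if_pos hs, hnhds]
        have h1 := limsup_eq_of_submean (u := fun w => spectralRadius ℂ (F w)) (c := z)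
          (upperSemicontinuousAt_spectralRadius_matrix (F := F)
            (han z (mem_ball_self hη)).continuousAt) hδ
          (fun r hr hrδ => spectralRadius_le_circleMean (F := F) hr
            (fun w hw => han w (closedBall_subset_ball (by linarith) hw)))
        rw [← h1]
        refine limsup_congr ?_
        filter_upwards [self_mem_nhdsWithin, nhdsWithin_le_nhds (ball_mem_nhds z hη)] with w hw hw'
        exact hrad w hw' hw
      · have hz' : z ∈ ball c η := closedBall_subset_ball (by linarith) hz
        rw [subharmonicExt, if_neg (hball hz' hzc).2]
        exact hrad z hz' hzc
  · obtain ⟨δ, hδ, hball⟩ := Metric.nhds_basis_closedBall.mem_iff.1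
      (hfin.isClosed.isOpen_compl.mem_nhds hs)
    refine ⟨_, δ, hδ, fun z hz => analyticAt_resolvent A E (hball hz),
      fun z hz => Or.inl (hball hz), fun z hz => ?_⟩
    rw [subharmonicExt, if_neg (hball hz)]; rfl

theorem subharmonicExt_isSubharmonicExtension (A E : Matrix (Fin n) (Fin n) ℂ) :
    IsSubharmonicExtension A E (subharmonicExt A E) where
  eq_on_resolventSet z hz := by rw [subharmonicExt, if_neg hz]
  eq_top z hz := by
    have hs : z ∈ spectrum ℂ A := by
      by_contra h; exact hz (Or.inl h)
    rw [subharmonicExt, if_pos hs]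
    by_contra h
    exact hz (Or.inr ⟨hs, lt_top_iff_ne_top.2 h⟩)
  subharmonic := by
    have : CompleteSpace (Matrix (Fin n) (Fin n) ℂ) := FiniteDimensional.complete ℂ _
    refine ⟨?_, ?_, ?_⟩
    · intro z hz
      obtain ⟨F, δ, hδ, hF, -, heq⟩ := exists_local_analytic A E hz
      rw [heq z (mem_closedBall_self hδ.le)]
      refine lt_of_le_of_lt (spectrum.spectralRadius_le_pow_nnnorm_pow_one_div ℂ (F z) 0) ?_
      simp [ENNReal.mul_lt_top_iff]
    · intro z hz
      obtain ⟨F, δ, hδ, hF, -, heq⟩ := exists_local_analytic A E hz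
      intro M hM
      rw [heq z (mem_closedBall_self hδ.le)] at hM
      refine Filter.Eventually.filter_mono nhdsWithin_le_nhds ?_
      filter_upwards [upperSemicontinuousAt_spectralRadius_matrix
        (hF z (mem_closedBall_self hδ.le)).continuousAt M hM, closedBall_mem_nhds z hδ] with w h1 h2
      rwa [heq w h2]
    · intro z hz
      obtain ⟨F, δ, hδ, hF, hsub, heq⟩ := exists_local_analytic A E hz
      refine ⟨δ, hδ, hsub, fun r hr hrδ => ?_⟩
      have hb : closedBall z r ⊆ closedBall z δ := closedBall_subset_closedBall hrδ
      have h1 := spectralRadius_le_circleMean hr (hF.mono hb)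
      have h2 : circleMean (fun w => spectralRadius ℂ (F w)) z r
          = circleMean (subharmonicExt A E) z r := by
        unfold circleMean
        congr 2
        funext θ
        rw [heq _ (hb (circleMap_mem_closedBall z hr.le θ))]
      rwa [heq z (mem_closedBall_self hδ.le), ← h2]

theorem IsSubharmonicExtension.eq_subharmonicExt {A E : Matrix (Fin n) (Fin n) ℂ}
    {u : ℂ → ℝ≥0∞} (hu : IsSubharmonicExtension A E u) : u = subharmonicExt A E := by
  have key : ∀ v w : ℂ → ℝ≥0∞, IsSubharmonicExtension A E v → IsSubharmonicExtension A E w →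
      ∀ z, v z = w z := by
    intro v w hv hw z
    have hfin : (spectrum ℂ A).Finite := Matrix.finite_spectrum A
    by_cases hz : z ∈ extDomain A E
    · have hlim : ∀ f : ℂ → ℝ≥0∞, IsSubharmonicExtension A E f → limsup f (𝓝[≠] z) = f z := by
        intro f hf
        obtain ⟨δ, hδ, hsub, hmean⟩ := hf.subharmonic.submean z hz
        refine limsup_eq_of_submean ?_ hδ hmean
        have := hf.subharmonic.usc z hz
        intro M hM
        have h1 := this M hM
        rwa [nhdsWithin_eq_nhds.2 (mem_of_superset (closedBall_mem_nhds z hδ) hsub)] at h1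
      rw [← hlim v hv, ← hlim w hw]
      refine limsup_congr ?_
      have hS : (spectrum ℂ A \ {z})ᶜ ∈ 𝓝 z :=
        (hfin.subset sdiff_subset).isClosed.isOpen_compl.mem_nhds (by simp)
      filter_upwards [self_mem_nhdsWithin, nhdsWithin_le_nhds hS] with x hx hx'
      have : x ∉ spectrum ℂ A := fun h => hx' ⟨h, hx⟩
      rw [hv.eq_on_resolventSet x this, hw.eq_on_resolventSet x this]
    · rw [hv.eq_top z hz, hw.eq_top z hz]
  exact funext (key _ _ hu (subharmonicExt_isSubharmonicExtension A E))

end MatrixNorm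

end DirectionalPseudospectrum

open DirectionalPseudospectrum

/-!
The eigenvalues of `A + t E` are tracked by spectral projections, written as Riesz integrals.

Let `K` be the directional pseudospectrum. For `z` outside the spectrum of `A` and `t ≠ 0`, the
point `z` is an eigenvalue of `A + t E` iff `-t⁻¹` is one of `E (A - z)⁻¹`
(`mem_spectrum_pencil_iff`).
Hence for `‖t‖ ≤ ε` every eigenvalue of `A + t E` lies in `K` or is an eigenvalue of `A`
(`spectrum_pencil_subset`), and every point of `K` is an eigenvalue of `A + t E` for some such `t`
(`exists_mem_spectrum_pencil`). The set `K` is closed, by upper semicontinuity of `φ`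
(`isClosed_dirPseudospectrum`), so its finitely many components are closed as well.

The rest is perturbation theory for two disjoint closed sets `C` and `D` whose union contains the
spectrum of `A + t E` for all `‖t‖ ≤ ε`. Near each `t₀` the spectral projection for `C` is a sum of
integrals of the resolvent over fixed small circles, so it is analytic in `t`
(`analyticAt_spectralProjection`, `analyticOnClosedDisc_spectralProjection`). Its trace is the
number of eigenvalues in `C`, a continuous integer-valued function, so this number does not
depend on `t` (`trace_spectralProjection`, `eigCount_pencil_eq`).

Taking for `C` a component of `K` gives the analyticity of its projection, the invariance of the
count, and, as the count is positive for some `t`, an eigenvalue in the component for every `t`.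
Taking for `C` a single eigenvalue of `A` outside `K` shows that it is an eigenvalue of every
`A + t E` (`spectrum_pencil_diff_dirPseudospectrum`). The identities between projections are checked
on generalized eigenspaces (`matrix_ext_of_maxGenEigenspace`, `spectralProjection_mulVec`).
-/

namespace DirectionalPseudospectrum

/-! ### Spectral projections of a matrix -/

section SpectralProjection

variable {n : ℕ}

theorem maxGenEigenspace_le_spectralSubspace (M : Matrix (Fin n) (Fin n) ℂ) {S : Set ℂ} {μ : ℂ}
    (hμ : μ ∈ S) :
    Module.End.maxGenEigenspace (Matrix.toLin' M) μ ≤ spectralSubspace M S :=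
  le_iSup₂_of_le μ hμ le_rfl

theorem maxGenEigenspace_eq_bot (M : Matrix (Fin n) (Fin n) ℂ) {μ : ℂ}
    (hμ : μ ∉ spectrum ℂ M) : Module.End.maxGenEigenspace (Matrix.toLin' M) μ = ⊥ := by
  by_contra h
  have h1 : Module.End.HasUnifEigenvalue (Matrix.toLin' M) μ ⊤ := h
  exact hμ (Matrix.spectrum_toLin' M ▸ (h1.lt zero_lt_one).mem_spectrum)

/-- A matrix is determined by its action on the generalized eigenspaces of another one. -/
theorem matrix_ext_of_maxGenEigenspace (M : Matrix (Fin n) (Fin n) ℂ)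
    {P Q : Matrix (Fin n) (Fin n) ℂ}
    (h : ∀ μ ∈ spectrum ℂ M, ∀ v ∈ Module.End.maxGenEigenspace (Matrix.toLin' M) μ,
      P.mulVec v = Q.mulVec v) : P = Q := by
  apply Matrix.toLin'.injective
  rw [← LinearMap.eqLocus_eq_top, eq_top_iff,
    ← Module.End.iSup_maxGenEigenspace_eq_top (Matrix.toLin' M)]
  refine iSup_le fun μ v hv => ?_
  by_cases hμ : μ ∈ spectrum ℂ M
  · simpa using h μ hμ v hv
  · rw [maxGenEigenspace_eq_bot M hμ, Submodule.mem_bot] at hv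
    simp [hv]

open Classical in
/-- Together with `matrix_ext_of_maxGenEigenspace` this reduces identities between spectral
projections to statements about single eigenvalues. -/
theorem spectralProjection_mulVec (M : Matrix (Fin n) (Fin n) ℂ) (S : Set ℂ) {μ : ℂ}
    {v : Fin n → ℂ} (hv : v ∈ Module.End.maxGenEigenspace (Matrix.toLin' M) μ) :
    (spectralProjection M S).mulVec v = if μ ∈ S then v else 0 := by
  rw [← Matrix.toLin'_apply, spectralProjection, Matrix.toLin'_toMatrix']
  split_ifs with hμ
  · exact Submodule.projection_apply_of_mem_left _ (maxGenEigenspace_le_spectralSubspace M hμ hv)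
  · rw [Submodule.projection_apply_eq_zero_iff]
    exact maxGenEigenspace_le_spectralSubspace M (S := Sᶜ) hμ hv

/-- Only the eigenvalues in `S` matter, so a set of eigenvalues may be replaced by a closed or open
set that contains it and no other eigenvalue. -/
theorem spectralProjection_congr (M : Matrix (Fin n) (Fin n) ℂ) {S T : Set ℂ}
    (h : spectrum ℂ M ∩ S = spectrum ℂ M ∩ T) :
    spectralProjection M S = spectralProjection M T := by
  classical
  refine matrix_ext_of_maxGenEigenspace M fun μ hμ v hv => ?_
  have : μ ∈ S ↔ μ ∈ T := by simpa [hμ] using Set.ext_iff.1 h μ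
  simp only [spectralProjection_mulVec M _ hv, this]

theorem sum_spectralProjection (M : Matrix (Fin n) (Fin n) ℂ) {ι : Type*} (s : Finset ι)
    (S : ι → Set ℂ) (hS : (s : Set ι).PairwiseDisjoint S) :
    ∑ i ∈ s, spectralProjection M (S i) = spectralProjection M (⋃ i ∈ s, S i) := by
  classical
  refine matrix_ext_of_maxGenEigenspace M fun μ _ v hv => ?_
  rw [Matrix.sum_mulVec, spectralProjection_mulVec M _ hv]
  simp only [spectralProjection_mulVec M _ hv]
  split_ifs with h
  · obtain ⟨i, hi, hμ⟩ := mem_iUnion₂.1 h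
    rw [Finset.sum_eq_single_of_mem i hi, if_pos hμ]
    intro j hj hji
    exact if_neg fun hμ' => (disjoint_left.1 (hS hi hj hji.symm)) hμ hμ'
  · refine Finset.sum_eq_zero fun i hi => if_neg fun hμ => h (mem_iUnion₂.2 ⟨i, hi, hμ⟩)

theorem spectralProjection_compl_add (M : Matrix (Fin n) (Fin n) ℂ) (S : Set ℂ) :
    spectralProjection M Sᶜ + spectralProjection M S = 1 := by
  classical
  refine matrix_ext_of_maxGenEigenspace M fun μ _ v hv => ?_
  rw [Matrix.add_mulVec, spectralProjection_mulVec M _ hv, spectralProjection_mulVec M _ hv,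
    Matrix.one_mulVec]
  by_cases h : μ ∈ S <;> simp [h]

theorem eigOn_spectralSubspace (M : Matrix (Fin n) (Fin n) ℂ) (S : Set ℂ) :
    eigOn M (spectralSubspace M S) = spectrum ℂ M ∩ S := by
  have key : ∀ {z : ℂ} {v : Fin n → ℂ}, M.mulVec v = z • v →
      v ∈ Module.End.maxGenEigenspace (Matrix.toLin' M) z := fun {z v} hv =>
    Module.End.genEigenspace_le_maximal (Matrix.toLin' M) z 1
      (Module.End.mem_eigenspace_iff.2 (by rw [Matrix.toLin'_apply, hv]))
  ext z
  constructor
  · rintro ⟨v, hvS, hv0, hv⟩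
    refine ⟨by_contra fun hz => hv0 ?_, by_contra fun hz => hv0 ?_⟩
    · simpa [maxGenEigenspace_eq_bot M hz] using key hv
    · exact Submodule.disjoint_def.1 (isCompl_spectralSubspace M S).disjoint v hvS
        (maxGenEigenspace_le_spectralSubspace M (S := Sᶜ) hz (key hv))
  · rintro ⟨hz, hzS⟩
    rw [← Matrix.spectrum_toLin'] at hz
    obtain ⟨v, hv⟩ := (Module.End.HasEigenvalue.of_mem_spectrum hz).exists_hasEigenvector
    have hv1 : M.mulVec v = z • v := by simpa using hv.apply_eq_smul
    exact ⟨v, maxGenEigenspace_le_spectralSubspace M hzS (key hv1), hv.2, hv1⟩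

theorem range_toLin'_spectralProjection (M : Matrix (Fin n) (Fin n) ℂ) (S : Set ℂ) :
    LinearMap.range (Matrix.toLin' (spectralProjection M S)) = spectralSubspace M S := by
  rw [spectralProjection, Matrix.toLin'_toMatrix', Submodule.range_projection]

theorem isSpectralProjection_spectralProjection (M : Matrix (Fin n) (Fin n) ℂ) {S : Set ℂ}
    (hS : S ⊆ spectrum ℂ M) : IsSpectralProjection M S (spectralProjection M S) where
  idem := by
    classical
    refine matrix_ext_of_maxGenEigenspace M fun μ _ v hv => ?_
    rw [← Matrix.mulVec_mulVec, spectralProjection_mulVec M _ hv]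
    split_ifs with h
    · rw [spectralProjection_mulVec M _ hv, if_pos h]
    · rw [Matrix.mulVec_zero]
  comm := by
    classical
    refine matrix_ext_of_maxGenEigenspace M fun μ _ v hv => ?_
    have hMv : M.mulVec v ∈ Module.End.maxGenEigenspace (Matrix.toLin' M) μ :=
      Module.End.mapsTo_maxGenEigenspace_of_comm (Commute.refl (Matrix.toLin' M)) μ hv
    rw [← Matrix.mulVec_mulVec, ← Matrix.mulVec_mulVec, spectralProjection_mulVec M _ hv,
      spectralProjection_mulVec M _ hMv]
    split_ifs
    · rfl
    · rw [Matrix.mulVec_zero]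
  eig_range := by
    rw [range_toLin'_spectralProjection, eigOn_spectralSubspace, inter_eq_right.2 hS]
  eig_ker := by
    rw [spectralProjection, Matrix.toLin'_toMatrix', Submodule.ker_projection,
      eigOn_spectralSubspace]
    rfl

theorem trace_spectralProjection_singleton (M : Matrix (Fin n) (Fin n) ℂ) (μ : ℂ) :
    (spectralProjection M {μ}).trace = (M.charpoly.rootMultiplicity μ : ℂ) := by
  -- The algebraic multiplicity is the dimension of the generalized eigenspace.
  have hsub : spectralSubspace M {μ} = Module.End.maxGenEigenspace (Matrix.toLin' M) μ := by
    simp [spectralSubspace]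
  have hproj : LinearMap.IsProj (spectralSubspace M {μ})
      (Matrix.toLin' (spectralProjection M {μ})) := by
    rw [spectralProjection, Matrix.toLin'_toMatrix']
    exact ⟨fun x => Submodule.projection_apply_mem _ x,
      fun x hx => Submodule.projection_apply_of_mem_left _ hx⟩
  rw [← Matrix.trace_toLin'_eq, hproj.trace, hsub, LinearMap.finrank_maxGenEigenspace_eq,
    Matrix.charpoly_toLin']

/-- The trace, that is the rank, of a spectral projection counts the eigenvalues it belongs to. -/
theorem trace_spectralProjection (M : Matrix (Fin n) (Fin n) ℂ) (S : Set ℂ) :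
    (spectralProjection M S).trace = (eigCount M S : ℂ) := by
  classical
  have hmem : ∀ μ, μ ∈ M.charpoly.roots ↔ μ ∈ spectrum ℂ M := fun μ => by
    rw [Polynomial.mem_roots (Matrix.charpoly_monic M).ne_zero,
      Matrix.mem_spectrum_iff_isRoot_charpoly]
  set s : Finset ℂ := {μ ∈ M.charpoly.roots.toFinset | μ ∈ S} with hs
  have h1 : spectralProjection M S = ∑ μ ∈ s, spectralProjection M {μ} := by
    rw [sum_spectralProjection M s _ (fun i _ j _ hij => by simpa using hij)]
    refine spectralProjection_congr M ?_
    ext μ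
    simp only [mem_inter_iff, mem_iUnion, mem_singleton_iff, hs, Finset.mem_filter,
      Multiset.mem_toFinset, hmem, exists_prop, exists_eq_right']
    tauto
  rw [h1, Matrix.trace_sum]
  simp only [trace_spectralProjection_singleton]
  rw [eigCount, ← Multiset.toFinset_sum_count_eq, Nat.cast_sum, Multiset.toFinset_filter]
  refine Finset.sum_congr (by ext; simp [hs]) fun μ hμ => ?_
  rw [Multiset.count_filter_of_pos (Finset.mem_filter.1 hμ).2, Polynomial.count_roots]

theorem eigCount_congr (M : Matrix (Fin n) (Fin n) ℂ) {S T : Set ℂ}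
    (h : spectrum ℂ M ∩ S = spectrum ℂ M ∩ T) : eigCount M S = eigCount M T := by
  have h1 := trace_spectralProjection M S
  rw [spectralProjection_congr M h, trace_spectralProjection M T] at h1
  exact_mod_cast h1.symm

theorem eigCount_pos_iff (M : Matrix (Fin n) (Fin n) ℂ) (S : Set ℂ) :
    0 < eigCount M S ↔ (spectrum ℂ M ∩ S).Nonempty := by
  classical
  rw [eigCount, Multiset.card_pos_iff_exists_mem]
  refine exists_congr fun μ => ?_
  rw [Multiset.mem_filter, Polynomial.mem_roots (Matrix.charpoly_monic M).ne_zero,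
    ← Matrix.mem_spectrum_iff_isRoot_charpoly]
  rfl

end SpectralProjection

/-! ### Circle integrals of the resolvent of a linear pencil -/

section Pencil

variable {𝒜 : Type*} [NormedRing 𝒜] [NormedAlgebra ℂ 𝒜] [CompleteSpace 𝒜]

theorem hasDerivAt_resolvent_pencil (a e : 𝒜) {t z : ℂ} (hz : z ∉ spectrum ℂ (a + t • e)) :
    HasDerivAt (fun s : ℂ => resolvent (a + s • e) z)
      (resolvent (a + t • e) z * e * resolvent (a + t • e) z) t := by
  obtain ⟨x, hx⟩ := spectrum.notMem_iff.1 hz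
  have h1 : HasDerivAt (fun s : ℂ => algebraMap ℂ 𝒜 z - (a + s • e)) (-e) t := by
    simpa using (((hasDerivAt_id t).smul_const e).const_add a).const_sub (algebraMap ℂ 𝒜 z)
  have h2 := hasFDerivAt_ringInverse (𝕜 := ℂ) x
  rw [hx] at h2
  have h3 := h2.comp_hasDerivAt t h1
  have h4 : resolvent (a + t • e) z = ((x⁻¹ : 𝒜ˣ) : 𝒜) := by
    rw [resolvent, ← hx, Ring.inverse_unit]
  rw [h4]
  exact h3.congr_deriv (by simp)

theorem continuousAt_resolvent_pencil (a e : 𝒜) {p : ℂ × ℂ}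
    (hp : p.2 ∉ spectrum ℂ (a + p.1 • e)) :
    ContinuousAt (fun q : ℂ × ℂ => resolvent (a + q.1 • e) q.2) p := by
  obtain ⟨x, hx⟩ := spectrum.notMem_iff.1 hp
  have h1 : Continuous fun q : ℂ × ℂ => algebraMap ℂ 𝒜 q.2 - (a + q.1 • e) := by
    have := continuous_algebraMap ℂ 𝒜
    fun_prop
  refine ContinuousAt.comp (g := Ring.inverse)
    (f := fun q : ℂ × ℂ => algebraMap ℂ 𝒜 q.2 - (a + q.1 • e)) ?_ h1.continuousAt
  rw [← hx]
  exact NormedRing.inverse_continuousAt x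

/-- Upper semicontinuity of the spectrum along the pencil. -/
theorem eventually_spectrum_pencil_subset (a e : 𝒜) {t : ℂ} {W : Set ℂ} (hW : IsOpen W)
    (h : spectrum ℂ (a + t • e) ⊆ W) : ∀ᶠ s in 𝓝 t, spectrum ℂ (a + s • e) ⊆ W := by
  have hc : ContinuousAt (fun s : ℂ => a + s • e) t := by fun_prop
  have h1 := upperHemicontinuousAt_iff.1 (upperHemicontinuous_spectrum ℂ 𝒜 (a + t • e)) W
    (hW.mem_nhdsSet.2 h)
  filter_upwards [hc.eventually h1] with s hs using subset_of_mem_nhdsSet hs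

theorem continuousOn_resolvent (b : 𝒜) {S : Set ℂ} (h : Disjoint S (spectrum ℂ b)) :
    ContinuousOn (resolvent b) S := by
  intro z hz
  -- The constant pencil `b + t • 0`.
  have h1 := continuousAt_resolvent_pencil b 0 (p := (0, z))
    (by simpa using disjoint_left.1 h hz)
  have h2 := h1.comp (f := fun w : ℂ => ((0 : ℂ), w)) (x := z) (by fun_prop)
  simpa [Function.comp_def] using h2.continuousWithinAt (s := S)

/-- Differentiation under the integral sign: the `t`-derivative `R e R` of the resolvent `R` is
bounded on the circle uniformly for nearby `t`. -/
theorem analyticAt_circleIntegral_resolvent_pencil (a e : 𝒜) {c t₀ : ℂ} {r : ℝ} (hr : 0 ≤ r)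
    (h : Disjoint (sphere c r) (spectrum ℂ (a + t₀ • e))) :
    AnalyticAt ℂ (fun t : ℂ => ∮ z in C(c, r), resolvent (a + t • e) z) t₀ := by
  have hopen : ∀ t, Disjoint (sphere c r) (spectrum ℂ (a + t • e)) →
      ∀ᶠ s in 𝓝 t, Disjoint (sphere c r) (spectrum ℂ (a + s • e)) := fun t ht => by
    filter_upwards [eventually_spectrum_pencil_subset a e isClosed_sphere.isOpen_compl
      (subset_compl_iff_disjoint_left.2 ht)] with s hs using subset_compl_iff_disjoint_left.1 hs
  rw [Complex.analyticAt_iff_eventually_differentiableAt]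
  filter_upwards [hopen t₀ h] with t ht
  obtain ⟨η, hη, hball⟩ := Metric.nhds_basis_closedBall.eventually_iff.1 (hopen t ht)
  have hcont : ContinuousOn (fun q : ℂ × ℂ => resolvent (a + q.1 • e) q.2)
      (closedBall t η ×ˢ sphere c r) := fun q hq =>
    (continuousAt_resolvent_pencil a e
      (disjoint_left.1 (hball hq.1) hq.2)).continuousWithinAt
  obtain ⟨C, hC⟩ := ((isCompact_closedBall t η).prod
    (isCompact_sphere c r)).exists_bound_of_continuousOn hcont
  have hmem : ∀ θ, circleMap c r θ ∈ sphere c r := fun θ => circleMap_mem_sphere c hr θ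
  have hcθ : ∀ s ∈ closedBall t η, Continuous fun θ => resolvent (a + s • e) (circleMap c r θ) :=
    fun s hs => (continuousOn_resolvent _ (hball hs)).comp_continuous
      (continuous_circleMap c r) hmem
  have hd : Continuous fun θ => deriv (circleMap c r) θ := by
    simp only [deriv_circleMap]; fun_prop
  have ht0 : t ∈ closedBall t η := mem_closedBall_self hη.le
  have key := intervalIntegral.hasDerivAt_integral_of_dominated_loc_of_deriv_le
    (μ := volume) (a := 0) (b := 2 * Real.pi) (x₀ := t) (s := closedBall t η)
    (F := fun s θ => deriv (circleMap c r) θ • resolvent (a + s • e) (circleMap c r θ))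
    (F' := fun s θ => deriv (circleMap c r) θ • (resolvent (a + s • e) (circleMap c r θ) * e *
      resolvent (a + s • e) (circleMap c r θ)))
    (bound := fun _ => r * (C * ‖e‖ * C))
    (closedBall_mem_nhds t hη) ?_ ?_ ?_ ?_ intervalIntegrable_const ?_
  · exact key.2.differentiableAt
  · filter_upwards [closedBall_mem_nhds t hη] with s hs
    exact (hd.smul (hcθ s hs)).aestronglyMeasurable
  · exact (hd.smul (hcθ t ht0)).intervalIntegrable _ _
  · exact (hd.smul (((hcθ t ht0).mul continuous_const).mul (hcθ t ht0))).aestronglyMeasurable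
  · refine Eventually.of_forall fun θ _ s hs => ?_
    have hb := hC (s, circleMap c r θ) ⟨hs, hmem θ⟩
    have hC0 : 0 ≤ C := (norm_nonneg _).trans hb
    rw [norm_smul]
    refine mul_le_mul (by simp [abs_of_nonneg hr]) ?_ (norm_nonneg _) hr
    refine (norm_mul_le _ _).trans (mul_le_mul ((norm_mul_le _ _).trans ?_) hb (norm_nonneg _)
      (by positivity))
    exact mul_le_mul_of_nonneg_right hb (norm_nonneg _)
  · refine Eventually.of_forall fun θ _ s hs => ?_
    exact (hasDerivAt_resolvent_pencil a e
      (disjoint_left.1 (hball hs) (hmem θ))).const_smul (deriv (circleMap c r) θ)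

end Pencil

/-! ### Riesz projections -/

theorem circleIntegral_clm_comp_comm {V W : Type*} [NormedAddCommGroup V] [NormedSpace ℂ V]
    [CompleteSpace V] [NormedAddCommGroup W] [NormedSpace ℂ W] [CompleteSpace W] (L : V →L[ℂ] W)
    {f : ℂ → V} {c : ℂ} {r : ℝ} (hf : CircleIntegrable f c r) :
    (∮ z in C(c, r), L (f z)) = L (∮ z in C(c, r), f z) := by
  simp only [circleIntegral, ← map_smul]
  exact L.intervalIntegral_comp_comm hf.out

section MatrixNorm

attribute [local instance] Matrix.linftyOpNormedRing Matrix.linftyOpNormedAlgebra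

variable {n : ℕ}

/-- The Neumann expansion of the resolvent in powers of `M - μ`, with remainder. On a generalized
eigenvector for `μ` the remainder vanishes for large `k`. -/
theorem resolvent_mulVec_eq_sum_add (M : Matrix (Fin n) (Fin n) ℂ) {μ z : ℂ} (hz : z ∉ spectrum ℂ M)
    (hzμ : z ≠ μ) (v : Fin n → ℂ) (k : ℕ) :
    (resolvent M z).mulVec v
      = ∑ i ∈ Finset.range k, (z - μ) ^ (-(i + 1 : ℤ)) • ((M - μ • 1) ^ i).mulVec v
        + (z - μ) ^ (-k : ℤ) • (resolvent M z).mulVec (((M - μ • 1) ^ k).mulVec v) := by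
  have hz0 : z - μ ≠ 0 := sub_ne_zero.2 hzμ
  have hstep : ∀ w : Fin n → ℂ, (resolvent M z).mulVec w =
      (z - μ)⁻¹ • w + (z - μ)⁻¹ • (resolvent M z).mulVec ((M - μ • 1).mulVec w) := by
    intro w
    have h1 : resolvent M z * (algebraMap ℂ _ z - M) = 1 :=
      Ring.inverse_mul_cancel _ (spectrum.notMem_iff.1 hz)
    -- Apply the resolvent to `(z - μ) w = (z - M) w + (M - μ) w`.
    have h2 : (z - μ) • w = (algebraMap ℂ (Matrix (Fin n) (Fin n) ℂ) z - M).mulVec w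
        + (M - μ • 1).mulVec w := by
      rw [← Matrix.add_mulVec, sub_add_sub_cancel, Algebra.algebraMap_eq_smul_one, ← sub_smul,
        Matrix.smul_mulVec, Matrix.one_mulVec]
    have h3 := congrArg (fun x => (resolvent M z).mulVec x) h2
    simp only [Matrix.mulVec_smul, Matrix.mulVec_add, Matrix.mulVec_mulVec, h1,
      Matrix.one_mulVec] at h3
    rw [← smul_add, eq_inv_smul_iff₀ hz0, Matrix.mulVec_mulVec]
    exact h3
  induction k with
  | zero => simp
  | succ k ih =>
    have hexp : (z - μ) ^ (-k : ℤ) * (z - μ)⁻¹ = (z - μ) ^ (-(k + 1 : ℤ)) := by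
      rw [← zpow_sub_one₀ hz0]; congr 1; ring
    rw [ih, Finset.sum_range_succ, hstep (((M - μ • 1) ^ k).mulVec v), smul_add, smul_smul,
      smul_smul, ← add_assoc, Matrix.mulVec_mulVec v, ← pow_succ', hexp]
    push_cast
    rfl

open Classical in
/-- The resolvent integral over a circle acts on a generalized eigenvector as `2πi` times the
identity or as zero. The resolvent of a generalized eigenvector is a finite sum of powers
`(z - μ) ^ (-i - 1)`, of which only the one with `i = 0` has a residue. -/
theorem circleIntegral_resolvent_mulVec (M : Matrix (Fin n) (Fin n) ℂ) {c μ : ℂ} {r : ℝ}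
    (hr : 0 ≤ r) (h : Disjoint (sphere c r) (spectrum ℂ M)) (hμ : μ ∈ spectrum ℂ M)
    {v : Fin n → ℂ} (hv : v ∈ Module.End.maxGenEigenspace (Matrix.toLin' M) μ) :
    (∮ z in C(c, r), resolvent M z).mulVec v
      = if μ ∈ ball c r then (2 * Real.pi * Complex.I : ℂ) • v else 0 := by
  have : CompleteSpace (Matrix (Fin n) (Fin n) ℂ) := FiniteDimensional.complete ℂ _
  obtain ⟨k, hk⟩ := (Module.End.mem_maxGenEigenspace _ _ _).1 hv
  have hk' : ((M - μ • 1) ^ k).mulVec v = 0 := by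
    rw [← hk, ← Matrix.toLin'_apply, Matrix.toLin'_pow, map_sub, map_smul, Matrix.toLin'_one]
    rfl
  have hne : ∀ z ∈ sphere c r, z ≠ μ := fun z hz hzμ => disjoint_left.1 h hz (hzμ ▸ hμ)
  have hμs : μ ∉ sphere c r := fun hs => hne μ hs rfl
  have hcont : ContinuousOn (resolvent M) (sphere c r) := continuousOn_resolvent M h
  let L : Matrix (Fin n) (Fin n) ℂ →L[ℂ] (Fin n → ℂ) :=
    LinearMap.toContinuousLinearMap ((Matrix.mulVecBilin ℂ ℂ).flip v)
  have hL : ∀ N, L N = N.mulVec v := fun N => rfl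
  have h1 : (∮ z in C(c, r), resolvent M z).mulVec v
      = ∮ z in C(c, r), (resolvent M z).mulVec v := by
    exact (circleIntegral_clm_comp_comm L (hcont.circleIntegrable hr)).symm
  have h2 : (∮ z in C(c, r), (resolvent M z).mulVec v)
      = ∮ z in C(c, r), ∑ i ∈ Finset.range k,
          (z - μ) ^ (-(i + 1 : ℤ)) • ((M - μ • 1) ^ i).mulVec v := by
    refine circleIntegral.integral_congr hr fun z hz => ?_
    rw [resolvent_mulVec_eq_sum_add M (disjoint_left.1 h hz) (hne z hz) v k, hk',
      Matrix.mulVec_zero, smul_zero, add_zero]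
  have h3 : ∀ i : ℕ, CircleIntegrable
      (fun z => (z - μ) ^ (-(i + 1 : ℤ)) • ((M - μ • 1) ^ i).mulVec v) c r := fun i => by
    refine ContinuousOn.circleIntegrable hr (ContinuousOn.fun_smul ?_ continuousOn_const)
    exact (continuousOn_id.sub continuousOn_const).zpow₀ _
      fun z hz => Or.inl (sub_ne_zero.2 (hne z hz))
  rw [h1, h2, circleIntegral.integral_fun_sum fun i _ => h3 i]
  simp only [circleIntegral.integral_smul_const]
  have h4 : ∀ i ≠ 0, (∮ z in C(c, r), (z - μ) ^ (-(i + 1 : ℤ))) = 0 := fun i hi =>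
    circleIntegral.integral_sub_zpow_of_ne (by omega) c μ r
  -- The sum has no term with `i = 0` when `k = 0`, but then `v = 0`.
  rcases Nat.eq_zero_or_pos k with rfl | hkpos
  · have hv0 : v = 0 := by simpa using hk'
    simp [hv0]
  rw [Finset.sum_eq_single_of_mem 0 (Finset.mem_range.2 hkpos)
    (fun i _ hi => by rw [h4 i (by exact_mod_cast hi), zero_smul])]
  simp only [pow_zero, Matrix.one_mulVec, Nat.cast_zero, zero_add, zpow_neg_one]
  split_ifs with hμb
  · rw [circleIntegral.integral_sub_inv_of_mem_ball hμb]
  · rw [DiffContOnCl.circleIntegral_eq_zero hr, zero_smul]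
    refine DifferentiableOn.diffContOnCl fun z hz => ?_
    have hz' := closure_ball_subset_closedBall hz
    have : z - μ ≠ 0 := by
      rw [sub_ne_zero]
      rintro rfl
      rw [← ball_union_sphere] at hz'
      exact hz'.elim hμb hμs
    exact ((differentiableAt_id.sub_const μ).inv this).differentiableWithinAt

end MatrixNorm

/-! ### Analytic dependence of spectral projections -/

section MatrixNorm

attribute [local instance] Matrix.linftyOpNormedRing Matrix.linftyOpNormedAlgebra

variable {n : ℕ}

theorem exists_separating_radius {s U V : Set ℂ} (hs : s.Finite) (hU : IsOpen U) (hV : IsOpen V) :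
    ∃ r > 0, (∀ μ ∈ s, μ ∈ U → ball μ r ⊆ U) ∧ (∀ μ ∈ s, μ ∈ V → ball μ r ⊆ V) ∧
      ∀ μ ∈ s, ∀ ν ∈ s, μ ≠ ν → Disjoint (closedBall μ r) (closedBall ν r) := by
  have hball : ∀ O : Set ℂ, IsOpen O → ∀ μ ∈ s, ∀ᶠ r : ℝ in 𝓝[>] 0, μ ∈ O → ball μ r ⊆ O := by
    intro O hO μ _
    by_cases hμ : μ ∈ O
    · obtain ⟨δ, hδ, h⟩ := Metric.isOpen_iff.1 hO μ hμ
      filter_upwards [Ioo_mem_nhdsGT hδ] with r hr _ using (ball_subset_ball hr.2.le).trans h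
    · exact Eventually.of_forall fun r h => absurd h hμ
  have hdisj : ∀ μ ∈ s, ∀ ν ∈ s, ∀ᶠ r : ℝ in 𝓝[>] 0,
      μ ≠ ν → Disjoint (closedBall μ r) (closedBall ν r) := by
    intro μ _ ν _
    by_cases hμν : μ = ν
    · exact Eventually.of_forall fun r h => absurd hμν h
    · filter_upwards [Ioo_mem_nhdsGT (half_pos (dist_pos.2 hμν))] with r hr _
      exact closedBall_disjoint_closedBall (by linarith [hr.2])
  have h := ((eventually_all_finite hs).2 (hball U hU)).and
    (((eventually_all_finite hs).2 (hball V hV)).and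
      ((eventually_all_finite hs).2 fun μ hμ => (eventually_all_finite hs).2 (hdisj μ hμ)))
  obtain ⟨r, hr, hr0⟩ := (h.and self_mem_nhdsWithin).exists
  exact ⟨r, hr0, hr⟩

/-- Near `t₀` the spectral projection is the sum of the Riesz integrals over small circles around
the eigenvalues of `A + t₀ E` in `U`. -/
theorem analyticAt_spectralProjection (A E : Matrix (Fin n) (Fin n) ℂ) {t₀ : ℂ} {U V : Set ℂ}
    (hU : IsOpen U) (hV : IsOpen V) (hUV : Disjoint U V)
    (hspec : spectrum ℂ (A + t₀ • E) ⊆ U ∪ V) :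
    AnalyticAt ℂ (fun t : ℂ => spectralProjection (A + t • E) U) t₀ := by
  classical
  have : CompleteSpace (Matrix (Fin n) (Fin n) ℂ) := FiniteDimensional.complete ℂ _
  have hfin : (spectrum ℂ (A + t₀ • E)).Finite := Matrix.finite_spectrum _
  obtain ⟨r, hr, hrU, hrV, hrd⟩ := exists_separating_radius hfin hU hV
  set s : Finset ℂ := hfin.toFinset with hs
  have hmem : ∀ μ, μ ∈ s ↔ μ ∈ spectrum ℂ (A + t₀ • E) := fun μ => hfin.mem_toFinset
  set W : Set ℂ := ⋃ μ ∈ s, ball μ r with hW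
  have hWopen : IsOpen W := isOpen_biUnion fun _ _ => isOpen_ball
  have hspecW : spectrum ℂ (A + t₀ • E) ⊆ W := fun μ hμ =>
    mem_iUnion₂.2 ⟨μ, (hmem μ).2 hμ, mem_ball_self hr⟩
  have hsphere : ∀ μ ∈ s, Disjoint (sphere μ r) W := by
    intro μ hμ
    refine disjoint_iUnion₂_right.2 fun ν hν => ?_
    by_cases h : μ = ν
    · exact h ▸ sphere_disjoint_ball
    · exact (hrd μ ((hmem μ).1 hμ) ν ((hmem ν).1 hν) h).mono sphere_subset_closedBall
        ball_subset_closedBall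
  have hQ : AnalyticAt ℂ (fun t : ℂ => ∑ μ ∈ s with μ ∈ U,
      (2 * Real.pi * Complex.I : ℂ)⁻¹ • ∮ z in C(μ, r), resolvent (A + t • E) z) t₀ :=
    Finset.analyticAt_fun_sum _ fun μ hμ => analyticAt_const.fun_smul
      (analyticAt_circleIntegral_resolvent_pencil A E hr.le
        ((hsphere μ (Finset.mem_filter.1 hμ).1).mono_right hspecW))
  refine hQ.congr ?_
  filter_upwards [eventually_spectrum_pencil_subset A E hWopen hspecW] with t ht
  refine matrix_ext_of_maxGenEigenspace (A + t • E) fun lam hlam v hv => ?_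
  have hint : ∀ μ ∈ s, ((2 * Real.pi * Complex.I : ℂ)⁻¹ •
      ∮ z in C(μ, r), resolvent (A + t • E) z).mulVec v = if lam ∈ ball μ r then v else 0 := by
    intro μ hμ
    rw [Matrix.smul_mulVec, circleIntegral_resolvent_mulVec _ hr.le
      ((hsphere μ hμ).mono_right ht) hlam hv]
    split_ifs
    · rw [smul_smul, inv_mul_cancel₀ Complex.two_pi_I_ne_zero, one_smul]
    · rw [smul_zero]
  rw [Matrix.sum_mulVec, spectralProjection_mulVec _ _ hv,
    Finset.sum_congr rfl fun μ hμ => hint μ (Finset.mem_filter.1 hμ).1]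
  obtain ⟨μ, hμ, hlamμ⟩ := mem_iUnion₂.1 (ht hlam)
  have hμspec := (hmem μ).1 hμ
  split_ifs with hlamU
  · have hμU : μ ∈ U := (hspec hμspec).resolve_right fun hμV =>
      disjoint_left.1 hUV hlamU (hrV μ hμspec hμV hlamμ)
    rw [Finset.sum_eq_single_of_mem μ (Finset.mem_filter.2 ⟨hμ, hμU⟩), if_pos hlamμ]
    intro ν hν hνμ
    exact if_neg fun hlamν => disjoint_left.1
      (hrd ν ((hmem ν).1 (Finset.mem_filter.1 hν).1) μ hμspec hνμ)
      (ball_subset_closedBall hlamν) (ball_subset_closedBall hlamμ)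
  · refine Finset.sum_eq_zero fun ν hν => if_neg fun hlamν => hlamU ?_
    obtain ⟨hνs, hνU⟩ := Finset.mem_filter.1 hν
    exact hrU ν ((hmem ν).1 hνs) hνU hlamν

/-- Closed sets that share out the spectra have disjoint open neighbourhoods `U` and `V`, which
still share them out for `t` slightly outside the disc. So the projection for `U`, unlike the one
for `C`, is analytic in a neighbourhood of the closed disc. -/
theorem exists_analyticOnNhd_spectralProjection (A E : Matrix (Fin n) (Fin n) ℂ) {ε : ℝ}
    {C D : Set ℂ} (hC : IsClosed C) (hD : IsClosed D) (hCD : Disjoint C D)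
    (hspec : ∀ t : ℂ, ‖t‖ ≤ ε → spectrum ℂ (A + t • E) ⊆ C ∪ D) :
    ∃ U : Set ℂ, AnalyticOnNhd ℂ (fun t : ℂ => spectralProjection (A + t • E) U)
        (closedBall 0 ε) ∧
      ∀ t : ℂ, ‖t‖ ≤ ε →
        spectrum ℂ (A + t • E) ∩ C = spectrum ℂ (A + t • E) ∩ U := by
  obtain ⟨U, V, hU, hV, hCU, hDV, hUV⟩ := normal_separation hC hD hCD
  refine ⟨U, fun t ht => analyticAt_spectralProjection A E hU hV hUV
    ((hspec t (mem_closedBall_zero_iff.1 ht)).trans (union_subset_union hCU hDV)), ?_⟩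
  intro t ht
  refine Subset.antisymm (inter_subset_inter_right _ hCU) fun z hz => ⟨hz.1, ?_⟩
  exact (hspec t ht hz.1).resolve_right fun hzD => disjoint_left.1 hUV hz.2 (hDV hzD)

theorem analyticOnClosedDisc_spectralProjection (A E : Matrix (Fin n) (Fin n) ℂ) {ε : ℝ}
    {C D : Set ℂ} (hC : IsClosed C) (hD : IsClosed D) (hCD : Disjoint C D)
    (hspec : ∀ t : ℂ, ‖t‖ ≤ ε → spectrum ℂ (A + t • E) ⊆ C ∪ D) :
    AnalyticOnClosedDisc (fun t => spectralProjection (A + t • E) C) ε := by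
  obtain ⟨U, hU, h⟩ := exists_analyticOnNhd_spectralProjection A E hC hD hCD hspec
  exact ⟨_, fun i k t ht => analyticAt_entry (hU t ht) i k, fun t ht =>
    spectralProjection_congr _ (h t (mem_closedBall_zero_iff.1 ht))⟩

/-- The number of eigenvalues in `C` is the trace of an analytic projection, hence a continuous
function of `t` with integer values on the connected disc. -/
theorem eigCount_pencil_eq (A E : Matrix (Fin n) (Fin n) ℂ) {ε : ℝ}
    {C D : Set ℂ} (hC : IsClosed C) (hD : IsClosed D) (hCD : Disjoint C D)
    (hspec : ∀ t : ℂ, ‖t‖ ≤ ε → spectrum ℂ (A + t • E) ⊆ C ∪ D) {s t : ℂ} (hs : ‖s‖ ≤ ε)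
    (ht : ‖t‖ ≤ ε) : eigCount (A + s • E) C = eigCount (A + t • E) C := by
  obtain ⟨U, hU, h⟩ := exists_analyticOnNhd_spectralProjection A E hC hD hCD hspec
  have htrace : ContinuousOn (fun t : ℂ => (spectralProjection (A + t • E) U).trace)
      (closedBall 0 ε) :=
    (Continuous.matrix_trace continuous_id).comp_continuousOn hU.continuousOn
  simp only [trace_spectralProjection] at htrace
  have hcont : ContinuousOn (fun t : ℂ => eigCount (A + t • E) U) (closedBall 0 ε) := by
    rw [Nat.isClosedEmbedding_coe_real.isInducing.continuousOn_iff]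
    simpa [Function.comp_def] using Complex.continuous_re.comp_continuousOn htrace
  rw [eigCount_congr _ (h s hs), eigCount_congr _ (h t ht)]
  exact (convex_closedBall (0 : ℂ) ε).isPreconnected.constant hcont
    (mem_closedBall_zero_iff.2 hs) (mem_closedBall_zero_iff.2 ht)

/-! ### The directional pseudospectrum -/

/-- The complement is open because `φ` is upper semicontinuous on its open domain, and `φ = ∞`
off it. -/
theorem isClosed_dirPseudospectrum (A E : Matrix (Fin n) (Fin n) ℂ) (ε : ℝ) :
    IsClosed (dirPseudospectrum A E ε) := by
  have hfin : (spectrum ℂ A).Finite := Matrix.finite_spectrum A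
  rw [← isOpen_compl_iff, isOpen_iff_mem_nhds]
  intro z hz
  have hlt : subharmonicExt A E z < ENNReal.ofReal ε⁻¹ := not_le.1 hz
  have hzD : z ∈ extDomain A E := by
    by_contra h
    rw [(subharmonicExt_isSubharmonicExtension A E).eq_top z h] at hlt
    exact not_top_lt hlt
  have hsub := (subharmonicExt_isSubharmonicExtension A E).subharmonic
  obtain ⟨δ, hδ, hball, -⟩ := hsub.submean z hzD
  have h1 := hsub.usc z hzD _ hlt
  rw [nhdsWithin_eq_nhds.2 (mem_of_superset (closedBall_mem_nhds z hδ) hball)] at h1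
  filter_upwards [h1] with w hw using not_le.2 hw

theorem mem_spectrum_pencil_iff (A E : Matrix (Fin n) (Fin n) ℂ) {t z : ℂ}
    (hz : z ∉ spectrum ℂ A) (ht : t ≠ 0) :
    z ∈ spectrum ℂ (A + t • E) ↔
      -t⁻¹ ∈ spectrum ℂ (E * (A - z • (1 : Matrix (Fin n) (Fin n) ℂ))⁻¹) := by
  have hu : IsUnit (A - z • (1 : Matrix (Fin n) (Fin n) ℂ)) := by
    rw [spectrum.notMem_iff, Algebra.algebraMap_eq_smul_one] at hz
    simpa using hz.neg
  have hinv : (A - z • (1 : Matrix (Fin n) (Fin n) ℂ))⁻¹ * (A - z • 1) = 1 :=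
    Matrix.nonsing_inv_mul _ ((Matrix.isUnit_iff_isUnit_det _).1 hu)
  -- `z - (A + t E) = t (-t⁻¹ - E (A - z)⁻¹) (A - z)`, and the outer factors are invertible.
  have key : algebraMap ℂ (Matrix (Fin n) (Fin n) ℂ) z - (A + t • E)
      = t • ((algebraMap ℂ (Matrix (Fin n) (Fin n) ℂ) (-t⁻¹) - E * (A - z • 1)⁻¹)
          * (A - z • 1)) := by
    rw [sub_mul, mul_assoc, hinv, mul_one, Algebra.algebraMap_eq_smul_one,
      Algebra.algebraMap_eq_smul_one, smul_mul_assoc, one_mul, smul_sub, smul_smul,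
      mul_neg, mul_inv_cancel₀ ht, neg_smul, one_smul]
    abel
  obtain ⟨u, hu⟩ := hu
  rw [spectrum.mem_iff, spectrum.mem_iff, key, not_iff_not, ← Units.smul_mk0 ht, isUnit_smul_iff,
    ← hu, Units.isUnit_mul_units]

theorem spectrum_pencil_subset (A E : Matrix (Fin n) (Fin n) ℂ) {ε : ℝ} {t : ℂ} (ht : ‖t‖ ≤ ε) :
    spectrum ℂ (A + t • E) ⊆ spectrum ℂ A ∪ dirPseudospectrum A E ε := by
  intro z hz
  by_cases hzA : z ∈ spectrum ℂ A
  · exact Or.inl hzA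
  right
  have ht0 : t ≠ 0 := by
    rintro rfl
    exact hzA (by simpa using hz)
  have h1 := (mem_spectrum_pencil_iff A E hzA ht0).1 hz
  rw [dirPseudospectrum, mem_ofPred_eq, subharmonicExt, if_neg hzA]
  refine le_trans ?_ (le_iSup₂ (f := fun (k : ℂ)
    (_ : k ∈ spectrum ℂ (E * (A - z • (1 : Matrix (Fin n) (Fin n) ℂ))⁻¹)) => (‖k‖₊ : ℝ≥0∞)) _ h1)
  rw [← enorm_eq_nnnorm, ← ofReal_norm, norm_neg, norm_inv]
  exact ENNReal.ofReal_le_ofReal (inv_anti₀ (norm_pos_iff.2 ht0) ht)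

/-- Every point of the pseudospectrum is an eigenvalue of `A + t E` for some `t` in the disc. At an
eigenvalue of `A` one takes `t = 0`; elsewhere `t = -w⁻¹`, where `w` is an eigenvalue of
`E (A - z)⁻¹` of largest modulus. -/
theorem exists_mem_spectrum_pencil (A E : Matrix (Fin n) (Fin n) ℂ) {ε : ℝ} (hε : 0 < ε) {z : ℂ}
    (hz : z ∈ dirPseudospectrum A E ε) : ∃ t : ℂ, ‖t‖ ≤ ε ∧ z ∈ spectrum ℂ (A + t • E) := by
  by_cases hzA : z ∈ spectrum ℂ A
  · exact ⟨0, by simpa using hε.le, by simpa using hzA⟩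
  have : CompleteSpace (Matrix (Fin n) (Fin n) ℂ) := FiniteDimensional.complete ℂ _
  rw [dirPseudospectrum, mem_ofPred_eq, subharmonicExt, if_neg hzA, resolventRadius] at hz
  have hpos : 0 < ENNReal.ofReal ε⁻¹ := ENNReal.ofReal_pos.2 (inv_pos.2 hε)
  have hne : (spectrum ℂ (E * (A - z • (1 : Matrix (Fin n) (Fin n) ℂ))⁻¹)).Nonempty := by
    by_contra h
    rw [not_nonempty_iff_eq_empty] at h
    rw [spectralRadius, h] at hz
    simp at hz
    linarith
  obtain ⟨w, hw, hwr⟩ := spectrum.exists_nnnorm_eq_spectralRadius_of_nonempty hne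
  rw [← hwr, ← enorm_eq_nnnorm, ← ofReal_norm,
    ENNReal.ofReal_le_ofReal_iff (norm_nonneg _)] at hz
  have hw0 : w ≠ 0 := norm_pos_iff.1 ((inv_pos.2 hε).trans_le hz)
  refine ⟨-w⁻¹, ?_, (mem_spectrum_pencil_iff A E hzA (by simpa using hw0)).2 ?_⟩
  · rw [norm_neg, norm_inv]
    exact inv_le_of_inv_le₀ hε hz
  · simpa using hw

/-- An eigenvalue of `A` off the pseudospectrum stays an eigenvalue: it is isolated from all other
possible eigenvalues of `A + t E`, so the count there does not change. -/
theorem spectrum_pencil_diff_dirPseudospectrum (A E : Matrix (Fin n) (Fin n) ℂ) {ε : ℝ} {t : ℂ}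
    (ht : ‖t‖ ≤ ε) :
    spectrum ℂ (A + t • E) ∩ (dirPseudospectrum A E ε)ᶜ
      = spectrum ℂ A ∩ (dirPseudospectrum A E ε)ᶜ := by
  have hfin : (spectrum ℂ A).Finite := Matrix.finite_spectrum A
  have h0 : ‖(0 : ℂ)‖ ≤ ε := by simpa using (norm_nonneg t).trans ht
  refine Subset.antisymm (fun z hz => ⟨(spectrum_pencil_subset A E ht hz.1).resolve_right hz.2,
    hz.2⟩) fun z hz => ⟨?_, hz.2⟩
  have hcount := eigCount_pencil_eq A E (C := {z})
    (D := spectrum ℂ A \ {z} ∪ dirPseudospectrum A E ε) isClosed_singleton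
    ((hfin.subset sdiff_subset).isClosed.union (isClosed_dirPseudospectrum A E ε))
    (by simpa using hz.2)
    (fun s hs w hw => by
      by_cases hwz : w = z
      · exact Or.inl hwz
      · exact Or.inr ((spectrum_pencil_subset A E hs hw).imp_left fun h => ⟨h, hwz⟩)) ht h0
  have h1 : 0 < eigCount (A + (0 : ℂ) • E) {z} :=
    (eigCount_pos_iff _ _).2 ⟨z, by simpa using hz.1, rfl⟩
  rw [← hcount, eigCount_pos_iff] at h1
  obtain ⟨w, hw, rfl⟩ := h1
  exact hw

end MatrixNorm

theorem isClosed_connectedComponentIn {X : Type*} [TopologicalSpace X] {F : Set X}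
    (hF : IsClosed F) (x : X) : IsClosed (connectedComponentIn F x) := by
  by_cases hx : x ∈ F
  · rw [connectedComponentIn_eq_image hx]
    exact hF.isClosedMap_subtype_val _ isClosed_connectedComponent
  · rw [connectedComponentIn_eq_empty hx]
    exact isClosed_empty

end DirectionalPseudospectrum

theorem mainTheorem7 {n m : ℕ} (A E : Matrix (Fin n) (Fin n) ℂ) (ε : ℝ) (hε : 0 < ε)
    (Δ : Fin m → Set ℂ) (hΔ_inj : Function.Injective Δ)
    (hΔ : Set.range Δ = {C | ∃ z ∈ dirPseudospectrum A E ε,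
      C = connectedComponentIn (dirPseudospectrum A E ε) z})
    (σ₀ : Set ℂ) (hσ₀ : σ₀ = spectrum ℂ A ∩ (dirPseudospectrum A E ε)ᶜ)
    (σ₀t : ℂ → Set ℂ)
    (hσ₀t : ∀ t, σ₀t t = spectrum ℂ (A + t • E) ∩ (dirPseudospectrum A E ε)ᶜ)
    (σ : Fin m → ℂ → Set ℂ) (hσ : ∀ j t, σ j t = spectrum ℂ (A + t • E) ∩ Δ j)
    (P₀ : ℂ → Matrix (Fin n) (Fin n) ℂ)
    (hP₀ : ∀ t, P₀ t = spectralProjection (A + t • E) (σ₀t t))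
    (P : Fin m → ℂ → Matrix (Fin n) (Fin n) ℂ)
    (hP : ∀ j t, P j t = spectralProjection (A + t • E) (σ j t)) :
    (∀ t : ℂ, ‖t‖ ≤ ε → σ₀t t = σ₀) ∧
    (∀ j, ∀ t : ℂ, ‖t‖ ≤ ε → (σ j t).Nonempty) ∧
    (∀ t : ℂ, ‖t‖ ≤ ε → IsSpectralProjection (A + t • E) (σ₀t t) (P₀ t)) ∧
    (∀ j, ∀ t : ℂ, ‖t‖ ≤ ε → IsSpectralProjection (A + t • E) (σ j t) (P j t)) ∧
    AnalyticOnClosedDisc P₀ ε ∧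
    (∀ j, AnalyticOnClosedDisc (P j) ε) ∧
    (∀ t : ℂ, ‖t‖ ≤ ε →
      eigOn (A + t • E) (LinearMap.range (Matrix.toLin' (P₀ t))) = σ₀) ∧
    (∀ j, ∀ t : ℂ, ‖t‖ ≤ ε →
      eigOn (A + t • E) (LinearMap.range (Matrix.toLin' (P j t))) = σ j t ∧ σ j t ⊆ Δ j) ∧
    (∀ t : ℂ, ‖t‖ ≤ ε → P₀ t + ∑ j, P j t = 1) ∧
    (∀ j, ∀ t : ℂ, ‖t‖ ≤ ε → eigCount (A + t • E) (Δ j) = eigCount A (Δ j)) := by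
  set K := dirPseudospectrum A E ε
  have hKclosed : IsClosed K := isClosed_dirPseudospectrum A E ε
  have hcomp : ∀ j, ∃ z ∈ K, Δ j = connectedComponentIn K z := fun j =>
    hΔ.subset (mem_range_self j)
  have hΔK : ∀ j, Δ j ⊆ K := fun j => by
    obtain ⟨z, -, h⟩ := hcomp j
    exact h ▸ connectedComponentIn_subset K z
  have hΔclosed : ∀ j, IsClosed (Δ j) := fun j => by
    obtain ⟨z, -, h⟩ := hcomp j
    exact h ▸ isClosed_connectedComponentIn hKclosed z
  have hΔdisj : Pairwise fun i j => Disjoint (Δ i) (Δ j) := fun i j hij => by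
    obtain ⟨z, -, hz⟩ := hcomp i
    obtain ⟨w, -, hw⟩ := hcomp j
    refine disjoint_left.2 fun x hxi hxj => hij (hΔ_inj ?_)
    rw [hz] at hxi ⊢
    rw [hw] at hxj ⊢
    rw [connectedComponentIn_eq hxi, connectedComponentIn_eq hxj]
  have hKΔ : K ⊆ ⋃ j, Δ j := fun z hz => by
    obtain ⟨j, hj⟩ := hΔ.superset ⟨z, hz, rfl⟩
    exact mem_iUnion.2 ⟨j, hj ▸ mem_connectedComponentIn hz⟩
  have hσ₀fin : σ₀.Finite := (Matrix.finite_spectrum A).subset (hσ₀ ▸ inter_subset_left)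
  have hσ₀K : Disjoint σ₀ K := hσ₀ ▸ disjoint_compl_left.mono_left inter_subset_right
  have hspec : ∀ t : ℂ, ‖t‖ ≤ ε → spectrum ℂ (A + t • E) ⊆ σ₀ ∪ K := fun t ht z hz => by
    by_cases hzK : z ∈ K
    · exact Or.inr hzK
    · exact Or.inl (hσ₀ ▸ ⟨(spectrum_pencil_subset A E ht hz).resolve_right hzK, hzK⟩)
  have hσ₀eq : ∀ t : ℂ, ‖t‖ ≤ ε → σ₀t t = σ₀ := fun t ht => by
    rw [hσ₀t, hσ₀, spectrum_pencil_diff_dirPseudospectrum A E ht]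
  -- For each `j` the spectra are shared out between `Δ j` and the union of the other pieces.
  have hD : ∀ j, IsClosed (σ₀ ∪ ⋃ i ∈ ({j}ᶜ : Set (Fin m)), Δ i) := fun j =>
    hσ₀fin.isClosed.union ((toFinite _).isClosed_biUnion fun i _ => hΔclosed i)
  have hdisj : ∀ j, Disjoint (Δ j) (σ₀ ∪ ⋃ i ∈ ({j}ᶜ : Set (Fin m)), Δ i) := fun j =>
    disjoint_union_right.2 ⟨(hσ₀K.mono_right (hΔK j)).symm,
      disjoint_iUnion₂_right.2 fun i hi => hΔdisj (Ne.symm hi)⟩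
  have hspecj : ∀ j, ∀ t : ℂ, ‖t‖ ≤ ε →
      spectrum ℂ (A + t • E) ⊆ Δ j ∪ (σ₀ ∪ ⋃ i ∈ ({j}ᶜ : Set (Fin m)), Δ i) := by
    intro j t ht z hz
    rcases hspec t ht hz with h | h
    · exact Or.inr (Or.inl h)
    · obtain ⟨i, hi⟩ := mem_iUnion.1 (hKΔ h)
      by_cases hij : i = j
      · exact Or.inl (hij ▸ hi)
      · exact Or.inr (Or.inr (mem_iUnion₂.2 ⟨i, hij, hi⟩))
  have hcount : ∀ j, ∀ s t : ℂ, ‖s‖ ≤ ε → ‖t‖ ≤ ε →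
      eigCount (A + s • E) (Δ j) = eigCount (A + t • E) (Δ j) := fun j s t hs ht =>
    eigCount_pencil_eq A E (hΔclosed j) (hD j) (hdisj j) (hspecj j) hs ht
  have hproj₀ : ∀ t : ℂ, IsSpectralProjection (A + t • E) (σ₀t t) (P₀ t) := fun t =>
    hP₀ t ▸ isSpectralProjection_spectralProjection _ (hσ₀t t ▸ inter_subset_left)
  have hproj : ∀ j, ∀ t : ℂ, IsSpectralProjection (A + t • E) (σ j t) (P j t) := fun j t =>
    hP j t ▸ isSpectralProjection_spectralProjection _ (hσ j t ▸ inter_subset_left)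
  have hPΔ : ∀ j t, P j t = spectralProjection (A + t • E) (Δ j) := fun j t => by
    rw [hP, hσ]
    exact spectralProjection_congr _ (by rw [← inter_assoc, inter_self])
  have hP₀K : ∀ t, P₀ t = spectralProjection (A + t • E) Kᶜ := fun t => by
    rw [hP₀, hσ₀t]
    exact spectralProjection_congr _ (by rw [← inter_assoc, inter_self])
  refine ⟨hσ₀eq, fun j t ht => ?_, fun t _ => hproj₀ t, fun j t _ => hproj j t, ?_, fun j => ?_,
    fun t ht => (hproj₀ t).eig_range.trans (hσ₀eq t ht),
    fun j t _ => ⟨(hproj j t).eig_range, hσ j t ▸ inter_subset_right⟩, fun t _ => ?_,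
    fun j t ht => ?_⟩
  · -- The count in `Δ j` is positive at a parameter that has a point of `Δ j` as an eigenvalue.
    obtain ⟨z, hz, hzj⟩ := hcomp j
    obtain ⟨s, hs, hzs⟩ := exists_mem_spectrum_pencil A E hε hz
    rw [hσ, ← eigCount_pos_iff, hcount j t s ht hs, eigCount_pos_iff]
    exact ⟨z, hzs, hzj ▸ mem_connectedComponentIn hz⟩
  · obtain ⟨Q, hQ, hQeq⟩ := analyticOnClosedDisc_spectralProjection A E hσ₀fin.isClosed hKclosed
      hσ₀K hspec
    refine ⟨Q, hQ, fun t ht => ?_⟩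
    rw [hP₀, hσ₀eq t (mem_closedBall_zero_iff.1 ht)]
    exact hQeq t ht
  · rw [funext (hPΔ j)]
    exact analyticOnClosedDisc_spectralProjection A E (hΔclosed j) (hD j) (hdisj j) (hspecj j)
  · have hUK : ⋃ j, Δ j = K := (iUnion_subset hΔK).antisymm hKΔ
    simp only [hPΔ, hP₀K]
    rw [sum_spectralProjection _ _ _ fun i _ j _ hij => hΔdisj hij]
    simp only [Finset.mem_univ, iUnion_true, hUK]
    exact spectralProjection_compl_add _ _
  · rw [hcount j t 0 ht (by simpa using hε.le), zero_smul, add_zero]
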